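/- For a set $\Omega$ and a subgroup $H\le \mathrm{Sym}(\Omega)$, the 2-closure of $H$ on $\Omega$ is $$H^{(2),\Omega}=\{\theta\in\mathrm{Sym}(\Omega)\mid \forall \alpha,\beta\in\Omega\ \exists h\in H:\ \alpha^\theta=\alpha^h,\ \beta^\theta=\beta^h\}.$$ A group $G$ is called 2-closed if $H=H^{(2),\Omega}$ for every set $\Omega$ and every subgroup $H\le\mathrm{Sym}(\Omega)$ with $H\cong G$. Let $Q_{2^n}$ ($n\ge 3$) denote the generalized quaternion group of order $2^n$ and $C_m$ the cyclic group of order $m$. Theorem. A finite nilpotent group $G$ is 2-closed if and only if $G$ is cyclic or $G\cong Q_{2^n}\times C_m$ for some $n\ge 3$ and some odd $m\ge 1$. -/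

import Mathlib

universe u v

/-- The 2-closure of a permutation group `H ≤ Sym(Ω)`: all permutations `θ` of `Ω` that agree,
on each pair of points of `Ω`, with some element of `H`. -/
def twoClosure {Ω : Type v} (H : Subgroup (Equiv.Perm Ω)) : Subgroup (Equiv.Perm Ω) where
  carrier := {θ | ∀ α β : Ω, ∃ g ∈ H, θ α = g α ∧ θ β = g β}
  one_mem' := fun _ _ => ⟨1, H.one_mem, rfl, rfl⟩
  mul_mem' := by
    intro a b ha hb α β
    obtain ⟨h, hh, h1, h2⟩ := hb α β
    obtain ⟨g, hg, g1, g2⟩ := ha (b α) (b β)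
    refine ⟨g * h, H.mul_mem hg hh, ?_, ?_⟩
    · rw [Equiv.Perm.mul_apply, Equiv.Perm.mul_apply, g1, h1]
    · rw [Equiv.Perm.mul_apply, Equiv.Perm.mul_apply, g2, h2]
  inv_mem' := by
    intro a ha α β
    obtain ⟨g, hg, g1, g2⟩ := ha (a⁻¹ α) (a⁻¹ β)
    refine ⟨g⁻¹, H.inv_mem hg, ?_, ?_⟩
    · rw [Equiv.Perm.eq_inv_iff_eq, ← g1]; exact Equiv.apply_symm_apply a _
    · rw [Equiv.Perm.eq_inv_iff_eq, ← g2]; exact Equiv.apply_symm_apply a _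

/-- An abstract group `G` is 2-closed if every permutation group isomorphic to `G`, on any set
`Ω` (of an arbitrary universe `v`, independent of that of `G`), equals its 2-closure. -/
def IsTwoClosedGroup (G : Type u) [Group G] : Prop :=
  ∀ (Ω : Type v) (H : Subgroup (Equiv.Perm Ω)), Nonempty (G ≃* H) → H = twoClosure H

/-- The generalized quaternion group `Q_{2^n}` of order `2^n`, for `n ≥ 3`. Mathlib's
`QuaternionGroup k` has order `4 * k`; the value for `n < 3` is not meaningful. -/
abbrev GenQuaternion (n : ℕ) : Type := QuaternionGroup (2 ^ (n - 2))

/-! For finite nilpotent `G`, both sides are equivalent to `HasUniquePrimeSubgroups G`.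

If `G` is 2-closed, actions on disjoint unions of coset spaces are used as tests: a permutation that
moves only one coset space must come from a single group element
(`IsTwoClosedGroup.exists_mem_cores`). This makes subgroups of prime order normal, and then unique.

Conversely, faithfulness and uniqueness give, for each prime `p`, a point whose stabilizer has no
`p`-torsion. The values of `θ` at these points fix all Sylow components of a candidate `c`, and `θ =
c` is checked one component at a time (`HasUniquePrimeSubgroups.eq_twoClosure`).

The classification is the classical one: a `p`-group with one subgroup of order `p` is cyclic or
generalized quaternion (`HasUniquePrimeSubgroups.isCyclic_or_quaternion`), applied to the Sylow
factors. -/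

/-- For every prime `p`, the group `G` has at most one subgroup of order `p`. -/
def HasUniquePrimeSubgroups (G : Type*) [Group G] : Prop :=
  ∀ x y : G, (orderOf x).Prime → orderOf x = orderOf y → y ∈ Subgroup.zpowers x

theorem HasUniquePrimeSubgroups.of_injective {G K : Type*} [Group G] [Group K]
    (hG : HasUniquePrimeSubgroups G) (f : K →* G) (hf : Function.Injective f) :
    HasUniquePrimeSubgroups K := by
  intro x y hx hxy
  obtain ⟨k, hk⟩ := hG (f x) (f y) (by rwa [orderOf_injective f hf])
    (by rw [orderOf_injective f hf, orderOf_injective f hf, hxy])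
  exact ⟨k, hf (by simpa using hk)⟩

/-! ### 2-closed groups and their subgroups of prime order -/

/-- If a 2-closed group acts faithfully on a finite type, then every permutation that agrees with
group elements on pairs of points is given by a group element. -/
theorem IsTwoClosedGroup.exists_smul_eq {G : Type u} [Group G] (hG : IsTwoClosedGroup.{u, v} G)
    {X : Type*} [Finite X] [MulAction G X] [FaithfulSMul G X] (θ : Equiv.Perm X)
    (hθ : ∀ α β : X, ∃ g : G, θ α = g • α ∧ θ β = g • β) : ∃ g : G, ∀ α, θ α = g • α := by
  obtain ⟨n, ⟨e₀⟩⟩ := Finite.exists_equiv_fin X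
  -- Finiteness of `X` lets the action be moved to a set in universe `v`.
  let e : X ≃ ULift.{v} (Fin n) := e₀.trans Equiv.ulift.symm
  let f : G →* Equiv.Perm (ULift.{v} (Fin n)) :=
    e.permCongrHom.toMonoidHom.comp (MulAction.toPermHom G X)
  have hf : Function.Injective f :=
    e.permCongrHom.injective.comp MulAction.toPerm_injective
  have hfe (g : G) (α : X) : f g (e α) = e (g • α) := by
    simp [f, Equiv.permCongrHom]
  have hmem : e.permCongrHom θ ∈ twoClosure f.range := by
    intro α β
    obtain ⟨g, h1, h2⟩ := hθ (e.symm α) (e.symm β)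
    refine ⟨f g, ⟨g, rfl⟩, ?_, ?_⟩
    · rw [← e.apply_symm_apply α, hfe, ← h1]; simp [Equiv.permCongrHom]
    · rw [← e.apply_symm_apply β, hfe, ← h2]; simp [Equiv.permCongrHom]
  rw [← hG _ f.range ⟨MonoidHom.ofInjective hf⟩] at hmem
  obtain ⟨g, hg⟩ := hmem
  refine ⟨g, fun α => e.injective ?_⟩
  rw [← hfe, hg]
  simp [Equiv.permCongrHom]

theorem QuotientGroup.smul_mk_eq_iff {G : Type*} [Group G] (B : Subgroup G) (g y : G) :
    g • (y : G ⧸ B) = y ↔ y⁻¹ * g * y ∈ B := by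
  change ((g * y : G) : G ⧸ B) = y ↔ _
  rw [eq_comm, QuotientGroup.eq, mul_assoc]

theorem QuotientGroup.smul_mk_eq_smul_mk_iff {G : Type*} [Group G] (N : Subgroup G) [N.Normal]
    (g w y : G) : w • (y : G ⧸ N) = g • (y : G ⧸ N) ↔ g⁻¹ * w ∈ N := by
  rw [← inv_smul_eq_iff, smul_smul, QuotientGroup.smul_mk_eq_iff]
  constructor
  · intro h
    have := ‹N.Normal›.conj_mem _ h y
    simpa [mul_assoc] using this
  · intro h
    have := ‹N.Normal›.conj_mem _ h y⁻¹
    simpa [mul_assoc] using this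

/-- The permutation of `G ⧸ N ⊕ G ⧸ B ⊕ G ⧸ C` that acts as `w` on `G ⧸ N` and trivially elsewhere
must come from a group element, as soon as it lies in the 2-closure. -/
theorem IsTwoClosedGroup.exists_mem_cores {G : Type u} [Group G] [Finite G]
    (hG : IsTwoClosedGroup.{u, v} G) (N B C : Subgroup G) [N.Normal] (w : G)
    (hB : ∀ y : G, ∃ g, y⁻¹ * g * y ∈ B ∧ g⁻¹ * w ∈ N)
    (hC : ∀ y : G, ∃ g, y⁻¹ * g * y ∈ C ∧ g⁻¹ * w ∈ N)
    (hf : ∀ g ∈ N, (∀ y, y⁻¹ * g * y ∈ B) → (∀ y, y⁻¹ * g * y ∈ C) → g = 1) :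
    ∃ g, g⁻¹ * w ∈ N ∧ (∀ y, y⁻¹ * g * y ∈ B) ∧ (∀ y, y⁻¹ * g * y ∈ C) := by
  have : FaithfulSMul G ((G ⧸ N) ⊕ (G ⧸ B) ⊕ (G ⧸ C)) := by
    refine ⟨fun {g₁ g₂} h => ?_⟩
    rw [eq_comm, ← inv_mul_eq_one]
    refine (hf (g₂⁻¹ * g₁) ?_ (fun y => ?_) fun y => ?_) ▸ (by group)
    · have := Sum.inl_injective (h (Sum.inl ((1 : G) : G ⧸ N)))
      exact (QuotientGroup.smul_mk_eq_smul_mk_iff _ _ _ _).1 this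
    · have := Sum.inl_injective (Sum.inr_injective (h (Sum.inr (Sum.inl (y : G ⧸ B)))))
      rw [← QuotientGroup.smul_mk_eq_iff, mul_smul, inv_smul_eq_iff]
      exact this
    · have := Sum.inr_injective (Sum.inr_injective (h (Sum.inr (Sum.inr (y : G ⧸ C)))))
      rw [← QuotientGroup.smul_mk_eq_iff, mul_smul, inv_smul_eq_iff]
      exact this
  let θ : Equiv.Perm ((G ⧸ N) ⊕ (G ⧸ B) ⊕ (G ⧸ C)) :=
    Equiv.sumCongr (MulAction.toPerm w) (Equiv.refl _)
  have hNN (x x' : G ⧸ N) : ∃ g : G, w • x = g • x ∧ w • x' = g • x' := ⟨w, rfl, rfl⟩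
  have hNB (x : G ⧸ N) (y : G ⧸ B) : ∃ g : G, w • x = g • x ∧ y = g • y := by
    induction x using QuotientGroup.induction_on with | _ x
    induction y using QuotientGroup.induction_on with | _ y
    obtain ⟨g, h1, h2⟩ := hB y
    exact ⟨g, (QuotientGroup.smul_mk_eq_smul_mk_iff _ _ _ _).2 h2,
      ((QuotientGroup.smul_mk_eq_iff _ _ _).2 h1).symm⟩
  have hNC (x : G ⧸ N) (y : G ⧸ C) : ∃ g : G, w • x = g • x ∧ y = g • y := by
    induction x using QuotientGroup.induction_on with | _ x
    induction y using QuotientGroup.induction_on with | _ y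
    obtain ⟨g, h1, h2⟩ := hC y
    exact ⟨g, (QuotientGroup.smul_mk_eq_smul_mk_iff _ _ _ _).2 h2,
      ((QuotientGroup.smul_mk_eq_iff _ _ _).2 h1).symm⟩
  obtain ⟨g, hg⟩ := hG.exists_smul_eq θ (by
    rintro (x | x | x) (y | y | y)
    · obtain ⟨g, h1, h2⟩ := hNN x y
      exact ⟨g, congrArg Sum.inl h1, congrArg Sum.inl h2⟩
    · obtain ⟨g, h1, h2⟩ := hNB x y
      exact ⟨g, congrArg Sum.inl h1, congrArg (Sum.inr ∘ Sum.inl) h2⟩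
    · obtain ⟨g, h1, h2⟩ := hNC x y
      exact ⟨g, congrArg Sum.inl h1, congrArg (Sum.inr ∘ Sum.inr) h2⟩
    · obtain ⟨g, h1, h2⟩ := hNB y x
      exact ⟨g, congrArg (Sum.inr ∘ Sum.inl) h2, congrArg Sum.inl h1⟩
    · exact ⟨1, (one_smul _ _).symm, (one_smul _ _).symm⟩
    · exact ⟨1, (one_smul _ _).symm, (one_smul _ _).symm⟩
    · obtain ⟨g, h1, h2⟩ := hNC y x
      exact ⟨g, congrArg (Sum.inr ∘ Sum.inr) h2, congrArg Sum.inl h1⟩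
    · exact ⟨1, (one_smul _ _).symm, (one_smul _ _).symm⟩
    · exact ⟨1, (one_smul _ _).symm, (one_smul _ _).symm⟩)
  refine ⟨g, ?_, fun y => ?_, fun y => ?_⟩
  · have := Sum.inl_injective (hg (Sum.inl ((1 : G) : G ⧸ N)))
    exact (QuotientGroup.smul_mk_eq_smul_mk_iff _ _ _ _).1 this
  · have := Sum.inl_injective (Sum.inr_injective (hg (Sum.inr (Sum.inl (y : G ⧸ B)))))
    exact (QuotientGroup.smul_mk_eq_iff _ _ _).1 this.symm
  · have := Sum.inr_injective (Sum.inr_injective (hg (Sum.inr (Sum.inr (y : G ⧸ C)))))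
    exact (QuotientGroup.smul_mk_eq_iff _ _ _).1 this.symm

/-- For nilpotent `G`, such an `N` makes `b` central modulo `N`: the preimage of the center of `G ⧸
N` is strictly larger than `N`. -/
theorem Subgroup.exists_maximal_normal_notMem {G : Type*} [Group G] [Finite G] {b : G}
    (hb : b ≠ 1) :
    ∃ N : Subgroup G, N.Normal ∧ b ∉ N ∧ ∀ M : Subgroup G, M.Normal → N < M → b ∈ M := by
  obtain ⟨N, hN⟩ := (Set.toFinite {N : Subgroup G | N.Normal ∧ b ∉ N}).exists_maximal
    ⟨⊥, inferInstance, by simpa using hb⟩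
  refine ⟨N, hN.prop.1, hN.prop.2, fun M hM hNM => ?_⟩
  by_contra h
  exact hNM.not_ge (hN.le_of_ge ⟨hM, h⟩ hNM.le)

theorem Subgroup.zpowers_eq_of_mem_of_prime {G : Type*} [Group G] {b x : G}
    (hb : (orderOf b).Prime) (hx : x ∈ zpowers b) (hx1 : x ≠ 1) : b ∈ zpowers x := by
  have hfin : IsOfFinOrder b := orderOf_pos_iff.1 hb.pos
  obtain ⟨k, rfl⟩ := hfin.mem_powers_iff_mem_zpowers.2 hx
  have hco : (orderOf b).Coprime k :=
    (Nat.Prime.coprime_iff_not_dvd hb).2 fun h => hx1 (orderOf_dvd_iff_pow_eq_one.1 h)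
  obtain ⟨m, hm⟩ := exists_pow_eq_self_of_coprime hco.symm
  exact ⟨m, by simpa using hm⟩

/-- In a 2-closed nilpotent group all subgroups of prime order are normal. -/
theorem IsTwoClosedGroup.normal_zpowers {G : Type u} [Group G] [Finite G] [Group.IsNilpotent G]
    (hG : IsTwoClosedGroup.{u, v} G) {b : G} (hb : (orderOf b).Prime) :
    (Subgroup.zpowers b).Normal := by
  have hb1 : b ≠ 1 := fun h => hb.ne_one (by simp [h])
  obtain ⟨N, hN, hbN, hmax⟩ := Subgroup.exists_maximal_normal_notMem hb1
  have hcent : ∀ y : G, y⁻¹ * b⁻¹ * y * b ∈ N := by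
    have : Nontrivial (G ⧸ N) := ⟨⟨(b : G ⧸ N), 1, by simpa using hbN⟩⟩
    have hne := Group.IsNilpotent.center_ne_bot (G := G ⧸ N)
    have hlt : N < (Subgroup.center (G ⧸ N)).comap (QuotientGroup.mk' N) := by
      refine lt_of_le_of_ne (fun x hx => ?_) fun h => hne ?_
      · rw [Subgroup.mem_comap, QuotientGroup.mk'_apply, (QuotientGroup.eq_one_iff x).2 hx]
        exact one_mem _
      · rw [eq_bot_iff]
        intro x hx
        induction x using QuotientGroup.induction_on with | _ x
        have : x ∈ N := by rw [h]; exact hx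
        simpa using this
    have hbc := hmax _ inferInstance hlt
    intro y
    rw [← QuotientGroup.eq_one_iff]
    have := Subgroup.mem_center_iff.1 (Subgroup.mem_comap.1 hbc) y
    simp only [QuotientGroup.mk'_apply] at this
    rw [mul_assoc, QuotientGroup.mk_mul, QuotientGroup.mk_mul _ y b, this]
    simp
  by_contra hnn
  have hcore : ∀ g : G, (∀ y, y⁻¹ * g * y ∈ Subgroup.zpowers b) → g = 1 := by
    intro g hg
    by_contra hg1
    refine hnn ⟨fun n hn y => ?_⟩
    have hgb : g ∈ Subgroup.zpowers b := by simpa using hg 1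
    have hbg := Subgroup.zpowers_eq_of_mem_of_prime hb hgb hg1
    obtain ⟨k, rfl⟩ := Subgroup.zpowers_le.2 hbg hn
    have := hg y⁻¹
    rw [inv_inv] at this
    simpa [conj_zpow] using zpow_mem this k
  -- The conjugate of `b` by `y` fixes the coset of `y` and acts on `G ⧸ N` as `b`, since `b` is
  -- central modulo `N`.
  have hw : ∀ y : G, ∃ g, y⁻¹ * g * y ∈ Subgroup.zpowers b ∧ g⁻¹ * b ∈ N := fun y =>
    ⟨y * b * y⁻¹, by simp [mul_assoc], by simpa [mul_assoc] using hcent y⁻¹⟩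
  obtain ⟨g, h1, h2, -⟩ := hG.exists_mem_cores N _ _ b hw hw fun g _ h _ => hcore g h
  rw [hcore g h2] at h1
  exact hbN (by simpa using h1)

/-- Distinct normal subgroups `⟨a⟩`, `⟨b⟩` of order `p` yield a third, `⟨ab⟩`. Acting as `b` on the
cosets of `⟨a⟩` and trivially on those of `⟨b⟩` and `⟨ab⟩` is allowed on pairs, by `b` or by `ab`;
but a group element doing so lies in `⟨b⟩ ∩ ⟨ab⟩ = 1`, so `b ∈ ⟨a⟩`. -/
theorem IsTwoClosedGroup.hasUniquePrimeSubgroups {G : Type u} [Group G] [Finite G]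
    [Group.IsNilpotent G] (hG : IsTwoClosedGroup.{u, v} G) : HasUniquePrimeSubgroups G := by
  intro a b ha hab
  have hb : (orderOf b).Prime := hab ▸ ha
  by_contra hba
  have hna := hG.normal_zpowers ha
  have hnb := hG.normal_zpowers hb
  have hdisj : Disjoint (Subgroup.zpowers a) (Subgroup.zpowers b) := by
    rw [Subgroup.disjoint_def]
    intro x hxa hxb
    by_contra hx
    exact hba (Subgroup.zpowers_le.2 hxa (Subgroup.zpowers_eq_of_mem_of_prime hb hxb hx))
  have hcomm : Commute a b := Subgroup.commute_of_normal_of_disjoint _ _ hna hnb hdisj a b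
    (Subgroup.mem_zpowers a) (Subgroup.mem_zpowers b)
  have hc1 : a * b ≠ 1 := fun h => hba <| by
    rw [← inv_eq_of_mul_eq_one_right h]
    exact inv_mem (Subgroup.mem_zpowers a)
  have hc : orderOf (a * b) = orderOf a := by
    have := Fact.mk ha
    refine orderOf_eq_prime ?_ hc1
    rw [hcomm.mul_pow, pow_orderOf_eq_one, hab, pow_orderOf_eq_one, one_mul]
  have hnc := hG.normal_zpowers (hc ▸ ha)
  have hbc : ∀ g, g ∈ Subgroup.zpowers b → g ∈ Subgroup.zpowers (a * b) → g = 1 := by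
    intro g hgb hgc
    by_contra hg1
    have h1 := Subgroup.zpowers_eq_of_mem_of_prime hb hgb hg1
    have h2 : b ∈ Subgroup.zpowers (a * b) := Subgroup.zpowers_le.2 hgc h1
    have h3 : a ∈ Subgroup.zpowers (a * b) := by
      simpa using mul_mem (Subgroup.mem_zpowers (a * b)) (inv_mem h2)
    have hb1 : b ≠ 1 := fun h => hb.ne_one (by simp [h])
    have h4 := Subgroup.zpowers_eq_of_mem_of_prime (hc ▸ ha) h2 hb1
    have h5 : a ∈ Subgroup.zpowers b := Subgroup.zpowers_le.2 h4 h3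
    have ha1 : a ≠ 1 := fun h => ha.ne_one (by simp [h])
    exact hba (Subgroup.zpowers_eq_of_mem_of_prime hb h5 ha1)
  obtain ⟨g, h1, h2, h3⟩ := hG.exists_mem_cores (Subgroup.zpowers a) (Subgroup.zpowers b)
    (Subgroup.zpowers (a * b)) b
    (fun y => ⟨b, by simpa using hnb.conj_mem b (Subgroup.mem_zpowers b) y⁻¹, by simp⟩)
    (fun y => ⟨a * b, by simpa using hnc.conj_mem _ (Subgroup.mem_zpowers (a * b)) y⁻¹, by
      rw [hcomm.eq]; simp⟩)
    (fun g _ h2 h3 => hbc g (by simpa using h2 1) (by simpa using h3 1))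
  have hg1 := hbc g (by simpa using h2 1) (by simpa using h3 1)
  subst hg1
  exact hba (by simpa using h1)

/-! ### Sylow components and sufficiency of unique prime subgroups -/

/-- A finite nilpotent group is the direct product of its nontrivial Sylow subgroups. -/
theorem Group.IsNilpotent.exists_mulEquiv_pi (G : Type*) [Group G] [Finite G]
    [Group.IsNilpotent G] :
    ∃ P : (Nat.card G).primeFactors → Subgroup G, (∀ p, IsPGroup p.1 (P p)) ∧
      (∀ p, Nontrivial (P p)) ∧ Nonempty ((∀ p, P p) ≃* G) := by
  have hprime (p : (Nat.card G).primeFactors) : Fact p.1.Prime :=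
    ⟨Nat.prime_of_mem_primeFactors p.2⟩
  let hu (p : (Nat.card G).primeFactors) : Unique (Sylow p G) :=
    Sylow.unique_of_normal default inferInstance
  obtain ⟨φ⟩ := ((Group.isNilpotent_of_finite_tfae (G := G)).out 0 4).mp ‹_›
  let S (p : (Nat.card G).primeFactors) : Sylow p G := (hu p).default
  refine ⟨fun p => S p, fun p => (S p).isPGroup', fun p => ?_, ⟨MulEquiv.trans ?_ φ⟩⟩
  · rw [Subgroup.nontrivial_iff_ne_bot]
    exact (S p).ne_bot_of_dvd_card (Nat.dvd_of_mem_primeFactors p.2)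
  · exact (MulEquiv.piCongrRight fun p =>
      letI := hu p
      MulEquiv.piUnique (fun P : Sylow p G => (P : Subgroup G))).symm

theorem IsPGroup.exists_orderOf_eq_prime {p : ℕ} (hp : p.Prime) {K : Type*} [Group K]
    (hK : IsPGroup p K) {x : K} (hx : x ≠ 1) : ∃ k : ℕ, orderOf (x ^ k) = p := by
  have := Fact.mk hp
  obtain ⟨n, hn⟩ := hK.exists_orderOf_eq_pow x
  obtain _ | n := n
  · exact absurd (orderOf_eq_one_iff.1 (by simpa using hn)) hx
  · refine ⟨p ^ n, ?_⟩
    rw [orderOf_pow_of_dvd (pow_ne_zero _ hp.ne_zero) (by rw [hn, pow_succ]; exact dvd_mul_right _ _),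
      hn, pow_succ, Nat.mul_div_cancel_left _ (pow_pos hp.pos _)]

/-- A subgroup of a product of groups of pairwise coprime orders contains the components of its
elements. -/
theorem Subgroup.mulSingle_mem_of_coprime {ι : Type*} [Finite ι] [DecidableEq ι]
    {P : ι → Type*} [∀ i, Group (P i)]
    (hP : Pairwise fun i j => (Nat.card (P i)).Coprime (Nat.card (P j)))
    (S : Subgroup (∀ i, P i)) {g : ∀ i, P i} (hg : g ∈ S) (i : ι) :
    Pi.mulSingle i (g i) ∈ S := by
  have := Fintype.ofFinite ι
  have hco : (Nat.card (P i)).Coprime (∏ j ∈ Finset.univ.erase i, Nat.card (P j)) :=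
    Nat.Coprime.prod_right fun j hj => hP (Finset.ne_of_mem_erase hj).symm
  -- Raising to the power `e` projects onto the factor `i`.
  obtain ⟨e, he1, he0⟩ := Nat.chineseRemainder hco 1 0
  have heq : Pi.mulSingle i (g i) = g ^ e := by
    funext j
    rw [Pi.pow_apply]
    obtain rfl | hj := eq_or_ne j i
    · have h1 : e ≡ 1 [MOD orderOf (g j)] := he1.of_dvd (_root_.orderOf_dvd_natCard _)
      rw [Pi.mulSingle_eq_same]
      simpa using (pow_eq_pow_iff_modEq.2 h1).symm
    · rw [Pi.mulSingle_eq_of_ne hj, eq_comm, ← orderOf_dvd_iff_pow_eq_one]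
      exact ((_root_.orderOf_dvd_natCard _).trans (Finset.dvd_prod_of_mem
        (fun j => Nat.card (P j)) (Finset.mem_erase.2 ⟨hj, Finset.mem_univ j⟩))).trans
        (Nat.modEq_zero_iff_dvd.1 he0)
  rw [heq]
  exact pow_mem hg e

theorem IsPGroup.pairwise_coprime_card {s : Finset ℕ} (hs : ∀ p ∈ s, p.Prime) {P : s → Type*}
    [∀ i, Group (P i)] [∀ i, Finite (P i)] (hP : ∀ p : s, IsPGroup p (P p)) :
    Pairwise fun p q => (Nat.card (P p)).Coprime (Nat.card (P q)) := by
  intro p q hpq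
  have := Fact.mk (hs p p.2)
  have := Fact.mk (hs q q.2)
  obtain ⟨m, hm⟩ := IsPGroup.iff_card.1 (hP p)
  obtain ⟨n, hn⟩ := IsPGroup.iff_card.1 (hP q)
  rw [hm, hn]
  exact Nat.coprime_pow_primes m n (hs p p.2) (hs q q.2) fun h => hpq (Subtype.ext h)

/-- A nilpotent permutation group with at most one subgroup of each prime order is 2-closed: for
each prime `p` it has a point whose stabilizer has no `p`-torsion. -/
theorem HasUniquePrimeSubgroups.eq_twoClosure {Ω : Type*} (H : Subgroup (Equiv.Perm Ω)) [Finite H]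
    [Group.IsNilpotent H] (hU : HasUniquePrimeSubgroups H) : H = twoClosure H := by
  refine le_antisymm (fun h hh α β => ⟨h, hh, rfl, rfl⟩) fun θ hθ => ?_
  obtain ⟨P, hP, hnt, ⟨f⟩⟩ := Group.IsNilpotent.exists_mulEquiv_pi H
  have hprime (p : (Nat.card H).primeFactors) : p.1.Prime := Nat.prime_of_mem_primeFactors p.2
  have hco := IsPGroup.pairwise_coprime_card (P := fun p => P p)
    (fun p hp => Nat.prime_of_mem_primeFactors hp) hP
  let act (g : ∀ p, P p) : Equiv.Perm Ω := f g
  have act_mul (g h : ∀ p, P p) (α : Ω) : act (g * h) α = act g (act h α) := by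
    simp [act]
  have act_inv (g : ∀ p, P p) (α β : Ω) : act g⁻¹ α = β ↔ α = act g β := by
    simp [act, Equiv.symm_apply_eq]
  let stab (α : Ω) : Subgroup (∀ p, P p) :=
    { carrier := {g | act g α = α}
      one_mem' := by simp [act]
      mul_mem' := fun {a b} ha hb => by
        simp only [Set.mem_ofPred_eq] at *
        rw [act_mul, hb, ha]
      inv_mem' := fun {a} ha => by
        simp only [Set.mem_ofPred_eq] at *
        rw [act_inv, ha] }
  have hpt : ∀ p, ∃ α, ∀ g ∈ stab α, g p = 1 := by
    intro p
    obtain ⟨z₀, hz₀⟩ := exists_ne (1 : P p)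
    obtain ⟨k, hz⟩ := (hP p).exists_orderOf_eq_prime (hprime p) hz₀
    set z := z₀ ^ k
    have hz1 : z ≠ 1 := fun h => (hprime p).ne_one (by rw [← hz, h, orderOf_one])
    have hinj : Function.Injective fun x : P p => f (Pi.mulSingle p x) :=
      f.injective.comp (Pi.mulSingle_injective p)
    have hne : act (Pi.mulSingle p z) ≠ 1 := fun h => hz1 (hinj (by
      apply Subtype.ext
      simpa [act] using h))
    obtain ⟨α, hα⟩ : ∃ α, act (Pi.mulSingle p z) α ≠ α := by
      by_contra! h
      exact hne (Equiv.ext h)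
    -- A stabilizer element with nontrivial `p`-component would put the unique subgroup of order
    -- `p`, hence `z`, into the stabilizer of `α`.
    refine ⟨α, fun g hg => ?_⟩
    by_contra hgp
    obtain ⟨l, hl⟩ := (hP p).exists_orderOf_eq_prime (hprime p) hgp
    let F : P p →* H := f.toMonoidHom.comp (MonoidHom.mulSingle (fun p => P p) p)
    obtain ⟨m, hm⟩ := hU.of_injective F hinj (g p ^ l) z (hl ▸ hprime p) (hl.trans hz.symm)
    have hmem : Pi.mulSingle p z ∈ stab α := by
      rw [← hm]
      have := zpow_mem (pow_mem (Subgroup.mulSingle_mem_of_coprime hco (stab α) hg p) l) m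
      simpa [Pi.mulSingle_pow, Pi.mulSingle_zpow] using this
    exact hα hmem
  choose a ha using hpt
  have hθ' : ∀ α β : Ω, ∃ g, θ α = act g α ∧ θ β = act g β := by
    intro α β
    obtain ⟨g, hg, h1, h2⟩ := hθ α β
    exact ⟨f.symm ⟨g, hg⟩, by simpa [act] using h1, by simpa [act] using h2⟩
  -- All `g` agreeing with `θ` at `a p` share one `p`-component; pairing `a p` with `β` carries it
  -- to `β`.
  have hloc : ∀ p, ∃ c : P p, ∀ β, ∃ g, g p = c ∧ θ β = act g β := by
    intro p
    obtain ⟨g₀, h0, -⟩ := hθ' (a p) (a p)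
    refine ⟨g₀ p, fun β => ?_⟩
    obtain ⟨g, h1, h2⟩ := hθ' (a p) β
    refine ⟨g, ?_, h2⟩
    have := ha p (g₀⁻¹ * g) (show act _ _ = _ by rw [act_mul, act_inv, ← h1, ← h0])
    simpa [inv_mul_eq_one, eq_comm] using this
  choose c hc using hloc
  suffices h : θ = act c by rw [h]; exact (f c).2
  ext β
  obtain ⟨g, hg, -⟩ := hθ' β β
  have hmem : c⁻¹ * g ∈ stab β := by
    refine Subgroup.pi_mem_of_mulSingle_mem _ fun p => ?_
    obtain ⟨k, hk, hkβ⟩ := hc p β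
    have : k⁻¹ * g ∈ stab β := show act _ _ = _ by rw [act_mul, act_inv, ← hg, ← hkβ]
    have := Subgroup.mulSingle_mem_of_coprime hco (stab β) this p
    simpa [hk] using this
  have : act (c⁻¹ * g) β = β := hmem
  rwa [act_mul, act_inv, ← hg] at this

theorem HasUniquePrimeSubgroups.isTwoClosedGroup {G : Type u} [Group G] [Finite G]
    [Group.IsNilpotent G] (hU : HasUniquePrimeSubgroups G) : IsTwoClosedGroup.{u, v} G := by
  rintro Ω H ⟨e⟩
  have : Finite H := Finite.of_equiv G e.toEquiv
  have : Group.IsNilpotent H := Group.nilpotent_of_mulEquiv e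
  exact (hU.of_injective e.symm.toMonoidHom e.symm.injective).eq_twoClosure H

/-! ### The groups in the list -/

theorem HasUniquePrimeSubgroups.of_isCyclic (G : Type*) [Group G] [Finite G] [IsCyclic G] :
    HasUniquePrimeSubgroups G := by
  intro x y _ hxy
  classical
  have := Fintype.ofFinite G
  have hsub : Finset.univ.filter (· ∈ Subgroup.zpowers x) ⊆
      Finset.univ.filter fun a : G => a ^ orderOf x = 1 := by
    intro a ha
    simp only [Finset.mem_filter, Finset.mem_univ, true_and] at ha ⊢
    exact orderOf_dvd_iff_pow_eq_one.1 (orderOf_dvd_of_mem_zpowers ha)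
  have hcard : (Finset.univ.filter (· ∈ Subgroup.zpowers x)).card = orderOf x := by
    rw [← Nat.card_zpowers, Nat.card_eq_fintype_card, Fintype.card_subtype]
  have heq := Finset.eq_of_subset_of_card_le hsub
    ((IsCyclic.card_pow_eq_one_le (orderOf_pos x)).trans hcard.ge)
  have hy : y ∈ Finset.univ.filter fun a : G => a ^ orderOf x = 1 := by
    simp [hxy, pow_orderOf_eq_one]
  rw [← heq] at hy
  simpa using hy

/-- Each `xa i` has order 4, so an involution lies in the cyclic part of order `2 * n`. -/
theorem QuaternionGroup.eq_a_of_sq_eq_one {n : ℕ} [NeZero n] {q : QuaternionGroup n}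
    (hq : q ^ 2 = 1) (hq1 : q ≠ 1) : q = a (n : ZMod (2 * n)) := by
  have hn : 0 < n := Nat.pos_of_neZero n
  obtain i | i := q
  · obtain ⟨k, hk, rfl⟩ : ∃ k < 2 * n, (k : ZMod (2 * n)) = i :=
      ⟨i.val, ZMod.val_lt i, ZMod.natCast_zmod_val i⟩
    have h0 : ((k + k : ℕ) : ZMod (2 * n)) = 0 := by
      rw [sq, a_mul_a, one_def, a.injEq] at hq
      exact_mod_cast hq
    obtain ⟨c, hc⟩ := (ZMod.natCast_eq_zero_iff _ _).1 h0
    have hkc : k = n * c := by linarith [mul_assoc 2 n c]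
    have hc2 : c < 2 := by
      by_contra! h
      nlinarith
    interval_cases c
    · simp [hkc] at hq1
    · simp [hkc]
  · have h4 := orderOf_xa i
    have := orderOf_dvd_of_pow_eq_one hq
    rw [h4] at this
    omega

theorem HasUniquePrimeSubgroups.of_quaternion_prod (n m : ℕ) (hm : Odd m) :
    HasUniquePrimeSubgroups (GenQuaternion n × Multiplicative (ZMod m)) := by
  have : NeZero m := ⟨hm.pos.ne'⟩
  rintro ⟨q, c⟩ ⟨q', c'⟩ hp hpq
  generalize hpdef : orderOf (q, c) = p at hp hpq
  have h1 := pow_orderOf_eq_one (q, c)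
  have h2 := pow_orderOf_eq_one (q', c')
  rw [hpdef, Prod.pow_mk, Prod.mk_eq_one] at h1
  rw [← hpq, Prod.pow_mk, Prod.mk_eq_one] at h2
  obtain rfl | hodd := hp.eq_two_or_odd'
  · have hc {c : Multiplicative (ZMod m)} (hc : c ^ 2 = 1) : c = 1 := by
      have hd : orderOf c ∣ m := by simpa using _root_.orderOf_dvd_natCard c
      have h2 := orderOf_dvd_of_pow_eq_one hc
      exact orderOf_eq_one_iff.1 (Nat.eq_one_of_dvd_coprimes
        (Nat.coprime_two_left.2 hm) h2 hd)
    have hq {q : GenQuaternion n} {c : Multiplicative (ZMod m)} (h : orderOf (q, c) = 2)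
        (hc : c = 1) :
        q ≠ 1 := by rintro rfl; subst hc; rw [← Prod.one_eq_mk, orderOf_one] at h; omega
    have e1 := QuaternionGroup.eq_a_of_sq_eq_one h1.1 (hq hpdef (hc h1.2))
    have e2 := QuaternionGroup.eq_a_of_sq_eq_one h2.1 (hq hpq.symm (hc h2.2))
    rw [hc h1.2, hc h2.2, e1, e2]
    exact Subgroup.mem_zpowers _
  · have hq {q : GenQuaternion n} (hq : q ^ p = 1) : q = 1 := by
      have hd : orderOf q ∣ 2 ^ (n - 2 + 2) := by
        have := _root_.orderOf_dvd_natCard q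
        rwa [Nat.card_eq_fintype_card, QuaternionGroup.card, show 4 = 2 ^ 2 from rfl, ← pow_add,
          add_comm] at this
      exact orderOf_eq_one_iff.1 (Nat.eq_one_of_dvd_coprimes
        ((Nat.coprime_two_left.2 hodd).pow_left _) hd (orderOf_dvd_of_pow_eq_one hq))
    have e1 := hq h1.1
    have e2 := hq h2.1
    subst e1 e2
    rw [Prod.orderOf_mk] at hpdef hpq
    simp only [orderOf_one, Nat.lcm_one_left] at hpdef hpq
    obtain ⟨k, hk⟩ := HasUniquePrimeSubgroups.of_isCyclic (Multiplicative (ZMod m)) c c'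
      (hpdef ▸ hp) (hpdef.trans hpq)
    exact ⟨k, by simpa using hk⟩

/-! ### Self-centralizing abelian normal subgroups -/

/-- In a nilpotent group, a normal subgroup not contained in the normal subgroup `A` contains an
element outside `A` that is central modulo `A`. -/
theorem Group.IsNilpotent.exists_mem_central_mod {G : Type*} [Group G] [Group.IsNilpotent G]
    (A C : Subgroup G) [C.Normal] (h : ¬ C ≤ A) :
    ∃ x ∈ C, x ∉ A ∧ ∀ y : G, x * y * x⁻¹ * y⁻¹ ∈ A := by
  classical
  obtain ⟨n, hn⟩ := Group.IsNilpotent.nilpotent G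
  have hex : ∃ i, ¬ Subgroup.upperCentralSeries G i ⊓ C ≤ A := ⟨n, by rwa [hn, top_inf_eq]⟩
  -- At the least such level, commutators drop one level while staying in `C`, hence land in `A`.
  obtain ⟨i, hi, hmin⟩ : ∃ i, ¬ Subgroup.upperCentralSeries G i ⊓ C ≤ A ∧
      ∀ j < i, Subgroup.upperCentralSeries G j ⊓ C ≤ A :=
    ⟨Nat.find hex, Nat.find_spec hex, fun j hj => not_not.1 (Nat.find_min hex hj)⟩
  obtain _ | i := i
  · simp at hi
  · obtain ⟨x, ⟨hxZ, hxC⟩, hxA⟩ := SetLike.not_le_iff_exists.1 hi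
    refine ⟨x, hxC, hxA, fun y => hmin i (Nat.lt_succ_self i) ⟨?_, ?_⟩⟩
    · exact Subgroup.mem_upperCentralSeries_succ_iff.1 hxZ y
    · rw [mul_assoc, mul_assoc]
      exact mul_mem hxC (by
        simpa [mul_assoc] using ‹C.Normal›.conj_mem _ (inv_mem hxC) y)

theorem Subgroup.exists_maximal_normal_commutative (G : Type*) [Group G] [Finite G] :
    ∃ A : Subgroup G, A.Normal ∧ (∀ x ∈ A, ∀ y ∈ A, x * y = y * x) ∧
      ∀ M : Subgroup G, M.Normal → (∀ x ∈ M, ∀ y ∈ M, x * y = y * x) → A ≤ M → M ≤ A := by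
  obtain ⟨A, hA⟩ := (Set.toFinite
    {A : Subgroup G | A.Normal ∧ ∀ x ∈ A, ∀ y ∈ A, x * y = y * x}).exists_maximal
    ⟨⊥, inferInstance, by simp⟩
  exact ⟨A, hA.prop.1, hA.prop.2, fun M h1 h2 h => hA.le_of_ge ⟨h1, h2⟩ h⟩

/-- A finite nilpotent group has a self-centralizing normal abelian subgroup. -/
theorem Group.IsNilpotent.exists_selfCentralizing (G : Type*) [Group G] [Finite G]
    [Group.IsNilpotent G] :
    ∃ A : Subgroup G, A.Normal ∧ (∀ x ∈ A, ∀ y ∈ A, x * y = y * x) ∧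
      Subgroup.centralizer (A : Set G) ≤ A := by
  obtain ⟨A, hA, hcomm, hmax⟩ := Subgroup.exists_maximal_normal_commutative G
  refine ⟨A, hA, hcomm, ?_⟩
  by_contra hC
  obtain ⟨x, hxC, hxA, hx⟩ := Group.IsNilpotent.exists_mem_central_mod A _ hC
  -- `M = ⟨x⟩A` is normal as `x` is central modulo `A`, and abelian as `x` centralizes `A`, against
  -- maximality.
  let M : Subgroup G := (Subgroup.zpowers (x : G ⧸ A)).comap (QuotientGroup.mk' A)
  have hMmem {g : G} (hg : g ∈ M) : ∃ i : ℤ, ∃ a ∈ A, g = x ^ i * a := by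
    obtain ⟨i, hi⟩ := hg
    refine ⟨i, (x ^ i)⁻¹ * g, ?_, by group⟩
    rw [← QuotientGroup.eq]
    simpa using hi
  have hxM : x ∈ M := Subgroup.mem_zpowers (x : G ⧸ A)
  have hAM : A ≤ M := fun a ha => by
    rw [Subgroup.mem_comap, QuotientGroup.mk'_apply, (QuotientGroup.eq_one_iff a).2 ha]
    exact one_mem _
  have hcen : (x : G ⧸ A) ∈ Subgroup.center (G ⧸ A) := by
    rw [Subgroup.mem_center_iff]
    intro y
    induction y using QuotientGroup.induction_on with | _ y
    have := (QuotientGroup.eq_one_iff _).2 (hx y)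
    rw [QuotientGroup.mk_mul, QuotientGroup.mk_mul, QuotientGroup.mk_mul,
      QuotientGroup.mk_inv, QuotientGroup.mk_inv, mul_inv_eq_one, mul_inv_eq_iff_eq_mul] at this
    exact this.symm
  have hMn : M.Normal := by
    have : (Subgroup.zpowers (x : G ⧸ A)).Normal := by
      refine ⟨fun n hn g => ?_⟩
      have : n ∈ Subgroup.center (G ⧸ A) := Subgroup.zpowers_le.2 hcen hn
      rw [Subgroup.mem_center_iff] at this
      rwa [this, mul_inv_cancel_right]
    exact this.comap _
  have hxa (i : ℤ) (a : G) (ha : a ∈ A) : Commute (x ^ i) a :=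
    Commute.zpow_left (Subgroup.mem_centralizer_iff.1 hxC a ha).symm i
  refine hxA (hmax M hMn (fun g hg h hh => ?_) hAM hxM)
  obtain ⟨i, a, ha, rfl⟩ := hMmem hg
  obtain ⟨j, b, hb, rfl⟩ := hMmem hh
  have h1 : Commute (x ^ i) (x ^ j * b) := ((Commute.refl x).zpow_zpow i j).mul_right (hxa i b hb)
  have h2 : Commute a (x ^ j * b) := (hxa j a ha).symm.mul_right (hcomm a ha b hb)
  exact h1.mul_left h2

theorem IsPGroup.exists_pow_notMem_pow_mem {p : ℕ} {G : Type*} [Group G]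
    (hG : IsPGroup p G) (A : Subgroup G) {x : G} (hx : x ∉ A) :
    ∃ j, x ^ p ^ j ∉ A ∧ x ^ p ^ (j + 1) ∈ A := by
  classical
  obtain ⟨n, hn⟩ := hG x
  have hex : ∃ i, x ^ p ^ i ∈ A := ⟨n, hn ▸ one_mem A⟩
  have h0 : Nat.find hex ≠ 0 := fun h => hx (by simpa [h] using Nat.find_spec hex)
  obtain ⟨j, hj⟩ := Nat.exists_eq_succ_of_ne_zero h0
  exact ⟨j, Nat.find_min hex (by omega), by simpa [hj] using Nat.find_spec hex⟩

/-! ### `p`-groups with a unique subgroup of order `p` -/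

section UniquePrimeSubgroup

variable {G : Type*} [Group G] {p : ℕ}

theorem HasUniquePrimeSubgroups.mem_zpowers_of_pow_eq_one (hU : HasUniquePrimeSubgroups G)
    (hp : p.Prime) (hG : IsPGroup p G) {α y : G} (hα : α ≠ 1) (hy : y ^ p = 1) :
    y ∈ Subgroup.zpowers α := by
  have := Fact.mk hp
  by_cases hy1 : y = 1
  · exact hy1 ▸ one_mem _
  obtain ⟨k, hk⟩ := hG.exists_orderOf_eq_prime hp hα
  have := hU (α ^ k) y (hk ▸ hp) (hk.trans (orderOf_eq_prime hy hy1).symm)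
  exact Subgroup.zpowers_le.2 (pow_mem (Subgroup.mem_zpowers α) k) this

theorem conj_pow_eq_pow {α x : G} {k : ℕ} (hk : x * α = α ^ k * x) (m : ℕ) (t : ℤ) :
    x ^ m * α ^ t = α ^ (t * (k ^ m : ℕ)) * x ^ m := by
  have h : ∀ m : ℕ, SemiconjBy (x ^ m) α (α ^ k ^ m) := by
    intro m
    induction m with
    | zero => simp
    | succ m ih =>
      have h1 : SemiconjBy x (α ^ k ^ m) ((α ^ k) ^ k ^ m) := SemiconjBy.pow_right hk _
      rw [← pow_mul, ← pow_succ'] at h1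
      rw [pow_succ' x]
      exact h1.mul_left ih
  have := ((h m).zpow_right t).eq
  rwa [← zpow_natCast α, ← zpow_mul, mul_comm _ t] at this

theorem mul_pow_eq_of_conj {α x : G} {k : ℕ} (hk : x * α = α ^ k * x) (m : ℕ) (t : ℤ) :
    (α ^ t * x) ^ m = α ^ (t * ((∑ i ∈ Finset.range m, k ^ i : ℕ) : ℤ)) * x ^ m := by
  induction m with
  | zero => simp
  | succ m ih =>
    rw [pow_succ, ih, mul_assoc, ← mul_assoc (x ^ m), conj_pow_eq_pow hk, mul_assoc, ← mul_assoc,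
      ← zpow_add, Finset.sum_range_succ, pow_succ x]
    push_cast
    rw [mul_add]

/-- If `x` normalizes `⟨α⟩`, acts on it as raising to the power `k`, and the norm
`1 + ⋯ + k ^ (p - 1)` is `p` times a unit, then `x` can be corrected to an element of order `p`. -/
theorem HasUniquePrimeSubgroups.mem_zpowers_of_norm (hU : HasUniquePrimeSubgroups G)
    (hp : p.Prime) (hG : IsPGroup p G) {α x : G} (hα : α ≠ 1) {k s : ℕ} {u : ℤ}
    (hk : x * α = α ^ k * x) (hs : x ^ p = α ^ (p * s))
    (hu : ((∑ i ∈ Finset.range p, k ^ i : ℕ) : ℤ) = p * u) (hup : IsCoprime u p) :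
    x ∈ Subgroup.zpowers α := by
  have := Fact.mk hp
  obtain ⟨n, hn⟩ := hG.exists_orderOf_eq_pow α
  -- With `v` inverse to `u` modulo the order of `α`, the `p`-th power of `α ^ (-v * s) * x` has
  -- exponent `-v * s * p * u + p * s ≡ 0`.
  obtain ⟨v, w, hvw⟩ : IsCoprime u ((p : ℤ) ^ n) := hup.pow_right
  have hy : (α ^ (-v * s : ℤ) * x) ^ p = 1 := by
    rw [mul_pow_eq_of_conj hk, hu, hs, ← zpow_natCast, ← zpow_add,
      ← orderOf_dvd_iff_zpow_eq_one, hn]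
    push_cast
    refine ⟨w * p * s, ?_⟩
    linear_combination (-p * s : ℤ) * hvw
  have := hU.mem_zpowers_of_pow_eq_one hp hG hα hy
  exact (Subgroup.mul_mem_cancel_left _ (zpow_mem (Subgroup.mem_zpowers α) _)).1 this

theorem mem_zpowers_pow_of_not_dvd (hp : p.Prime) (hG : IsPGroup p G) (α : G) {s : ℕ}
    (hs : ¬ p ∣ s) : α ∈ Subgroup.zpowers (α ^ s) := by
  have := Fact.mk hp
  obtain ⟨n, hn⟩ := hG.exists_orderOf_eq_pow α
  obtain ⟨m, hm⟩ := exists_pow_eq_self_of_coprime (x := α) (n := s)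
    (hn ▸ ((Nat.Prime.coprime_iff_not_dvd hp).2 hs).symm.pow_right n)
  exact ⟨m, by simpa using hm⟩

/-- Commutative subgroups are cyclic. -/
theorem HasUniquePrimeSubgroups.exists_eq_zpowers [Finite G] (hU : HasUniquePrimeSubgroups G)
    (hp : p.Prime) (hG : IsPGroup p G) (A : Subgroup G) (hA : ∀ x ∈ A, ∀ y ∈ A, x * y = y * x) :
    ∃ α, A = Subgroup.zpowers α := by
  obtain ⟨α, hαA, hmax⟩ := (Set.toFinite (A : Set G)).exists_maximalFor orderOf _ ⟨1, one_mem A⟩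
  refine ⟨α, le_antisymm (fun y hy => ?_) (Subgroup.zpowers_le.2 hαA)⟩
  by_contra hyα
  have key : ∀ y ∈ A, y ^ p ∈ Subgroup.zpowers α → y ∈ Subgroup.zpowers α := by
    intro y hy hyp
    by_cases hα : α = 1
    · have hle := hmax hy (by rw [hα, orderOf_one]; exact orderOf_pos y)
      rw [hα, orderOf_one] at hle
      have : y = 1 := orderOf_eq_one_iff.1 (le_antisymm hle (orderOf_pos y))
      exact this ▸ one_mem _
    obtain ⟨s, hs⟩ := mem_powers_iff_mem_zpowers.2 hyp
    simp only at hs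
    -- If `p ∣ s`, the norm lemma applies with trivial action; otherwise `⟨α⟩ ≤ ⟨y⟩`, with equality
    -- by maximality of the order.
    by_cases hps : p ∣ s
    · obtain ⟨s, rfl⟩ := hps
      exact hU.mem_zpowers_of_norm hp hG (k := 1) (u := 1) hα (by simp [hA y hy α hαA]) hs.symm
        (by simp) isCoprime_one_left
    · have h1 := mem_zpowers_pow_of_not_dvd hp hG α hps
      rw [hs] at h1
      have h2 : Subgroup.zpowers α ≤ Subgroup.zpowers y :=
        Subgroup.zpowers_le.2 (Subgroup.zpowers_le.2 (pow_mem (Subgroup.mem_zpowers y) p) h1)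
      have hle := hmax hy (by
        rw [← Nat.card_zpowers, ← Nat.card_zpowers]; exact Subgroup.card_le_of_le h2)
      rw [← Nat.card_zpowers, ← Nat.card_zpowers] at hle
      rw [Subgroup.eq_of_le_of_card_ge h2 hle]
      exact Subgroup.mem_zpowers y
  obtain ⟨j, hj1, hj2⟩ := hG.exists_pow_notMem_pow_mem _ hyα
  exact hj1 (key _ (pow_mem hy _) (by rwa [← pow_mul, ← pow_succ]))

end UniquePrimeSubgroup

/-- Recognition of dicyclic groups. -/
theorem QuaternionGroup.nonempty_mulEquiv {G : Type*} [Group G] {m : ℕ} {α x : G}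
    (hα : orderOf α = 2 * m) (hx : x ∉ Subgroup.zpowers α) (hconj : α * x = x * α⁻¹)
    (hsq : x ^ 2 = α ^ m) (hgen : ∀ g ∉ Subgroup.zpowers α, x⁻¹ * g ∈ Subgroup.zpowers α) :
    Nonempty (QuaternionGroup m ≃* G) := by
  let F : ZMod (2 * m) →+ Additive G := ZMod.lift (2 * m)
    ⟨zmultiplesHom (Additive G) (Additive.ofMul α), by
      rw [← hα]; simp [← ofMul_pow, pow_orderOf_eq_one]⟩
  let f (i : ZMod (2 * m)) : G := (F i).toMul
  have f_add (i j) : f (i + j) = f i * f j := by simp [f]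
  have f_neg (i) : f (-i) = (f i)⁻¹ := by simp [f]
  have f_int (k : ℤ) : f k = α ^ k := by simp [f, F, ZMod.lift_coe]
  have f_nat : f (m : ZMod (2 * m)) = x ^ 2 := by
    rw [hsq, ← zpow_natCast, ← f_int]; simp
  have f_mem (i) : f i ∈ Subgroup.zpowers α := by
    obtain ⟨k, rfl⟩ := ZMod.intCast_surjective i
    exact ⟨k, (f_int k).symm⟩
  have f_inj : Function.Injective f := by
    intro i j hij
    obtain ⟨k, rfl⟩ := ZMod.intCast_surjective i
    obtain ⟨l, rfl⟩ := ZMod.intCast_surjective j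
    rw [f_int, f_int, zpow_eq_zpow_iff_modEq, hα] at hij
    exact (ZMod.intCast_eq_intCast_iff _ _ _).2 hij
  have f_conj (i) : f i * x = x * (f i)⁻¹ := by
    obtain ⟨k, rfl⟩ := ZMod.intCast_surjective i
    have h : SemiconjBy x α⁻¹ α := hconj.symm
    rw [f_int, ← inv_zpow]
    exact (h.zpow_right k).eq.symm
  let φ : QuaternionGroup m →* G := MonoidHom.mk' (fun
      | a i => f i
      | xa i => x * f i) (by
    rintro (i | i) (j | j)
    · simp [f_add]
    · simp only [a_mul_xa, sub_eq_add_neg]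
      rw [← mul_assoc, f_conj, add_comm, f_add, f_neg, mul_assoc]
    · simp [f_add, mul_assoc]
    · simp only [xa_mul_xa]
      rw [mul_assoc, ← mul_assoc (f i), f_conj, add_sub_assoc, f_add, f_nat, sub_eq_neg_add, f_add,
        f_neg, sq]
      simp only [mul_assoc])
  refine ⟨MulEquiv.ofBijective φ ⟨?_, fun g => ?_⟩⟩
  · rw [injective_iff_map_eq_one]
    rintro (i | i) hi
    · have : f i = f 0 := by rw [show f i = 1 from hi]; simp [f]
      rw [f_inj this, a_zero]
    · have hi : x * f i = 1 := hi
      refine absurd ?_ hx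
      rw [eq_inv_of_mul_eq_one_left hi]
      exact inv_mem (f_mem i)
  · by_cases hg : g ∈ Subgroup.zpowers α
    · obtain ⟨k, rfl⟩ := hg
      exact ⟨a k, f_int k⟩
    · obtain ⟨k, hk⟩ := hgen g hg
      refine ⟨xa k, ?_⟩
      change x * f k = g
      rw [f_int]
      simp only at hk
      rw [hk, mul_inv_cancel_left]

section UniquePrimeSubgroup

variable {G : Type*} [Group G] {p : ℕ}

theorem HasUniquePrimeSubgroups.eq_of_involutions (hU : HasUniquePrimeSubgroups G) {y z : G}
    (hy : y ^ 2 = 1) (hy1 : y ≠ 1) (hz : z ^ 2 = 1) (hz1 : z ≠ 1) : y = z := by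
  have hyo : orderOf y = 2 := orderOf_eq_prime hy hy1
  have hzo : orderOf z = 2 := orderOf_eq_prime hz hz1
  obtain ⟨k, hk⟩ := hU y z (hyo ▸ Nat.prime_two) (hyo.trans hzo.symm)
  simp only at hk
  have h2 : y ^ (2 : ℤ) = 1 := by exact_mod_cast hy
  obtain ⟨l, rfl | rfl⟩ := Int.even_or_odd' k
  · rw [zpow_mul, h2, one_zpow] at hk
    exact absurd hk.symm hz1
  · rw [zpow_add, zpow_mul, h2, one_zpow, one_mul, zpow_one] at hk
    exact hk

/-- Writing `k = 1 + p * b`, the norm is `p` modulo `p ^ 2` for odd `p`. For `p = 2` it is `1 + k`,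
divisible by 4 when `k ≡ 3 [MOD 4]`: this is where quaternion groups come from. -/
theorem exists_norm_eq_mul {p k : ℕ} (hp : p.Prime) (hk : k ≡ 1 [MOD p])
    (h4 : p = 2 → k ≡ 1 [MOD 4]) :
    ∃ u : ℤ, ((∑ i ∈ Finset.range p, k ^ i : ℕ) : ℤ) = p * u ∧ IsCoprime u p := by
  obtain rfl | hodd := hp.eq_two_or_odd'
  · have := h4 rfl
    obtain ⟨j, rfl⟩ : ∃ j, k = 1 + 4 * j := ⟨k / 4, by unfold Nat.ModEq at this; omega⟩
    refine ⟨1 + 2 * j, ?_, 1, -j, ?_⟩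
    · simp [Finset.sum_range_succ]; ring
    · push_cast; ring
  · obtain ⟨b, hb⟩ : (p : ℤ) ∣ k - 1 := by
      have := (Int.natCast_modEq_iff.2 hk).symm.dvd
      simpa using this
    have hkb : (k : ℤ) = 1 + p * b := by linarith
    obtain ⟨c, hc⟩ := odd_sq_dvd_geom_sum₂_sub (R := ℤ) (a := 1) (b := b) hodd
    refine ⟨1 + p * c, ?_, 1, -c, by ring⟩
    push_cast
    rw [hkb]
    simp only [one_pow, mul_one] at hc
    linear_combination hc

/-- The elements outside a self-centralizing cyclic normal subgroup, and of order `p` modulo it,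
invert it and square to its involution. -/
theorem HasUniquePrimeSubgroups.inverts_of_pow_mem (hU : HasUniquePrimeSubgroups G)
    [Finite G] (hp : p.Prime) (hG : IsPGroup p G) {α x : G}
    (hnorm : (Subgroup.zpowers α).Normal)
    (hcent : ∀ y, Commute y α → y ∈ Subgroup.zpowers α)
    (hx : x ∉ Subgroup.zpowers α) (hxp : x ^ p ∈ Subgroup.zpowers α) :
    p = 2 ∧ α * x = x * α⁻¹ ∧ x ^ 2 ≠ 1 ∧ (x ^ 2) ^ 2 = 1 := by
  have := Fact.mk hp
  have hα : α ≠ 1 := by rintro rfl; exact hx (hcent x (Commute.one_right x))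
  obtain ⟨n, hn⟩ := hG.exists_orderOf_eq_pow α
  have hn0 : n ≠ 0 := by rintro rfl; exact hα (orderOf_eq_one_iff.1 (by simpa using hn))
  obtain ⟨k, hk⟩ : ∃ k : ℕ, x * α = α ^ k * x := by
    obtain ⟨k, hk⟩ := mem_powers_iff_mem_zpowers.2
      (hnorm.conj_mem α (Subgroup.mem_zpowers α) x)
    exact ⟨k, by simp only at hk; rw [hk]; group⟩
  obtain ⟨s, hs⟩ := mem_powers_iff_mem_zpowers.2 hxp
  simp only at hs
  have hps : p ∣ s := by
    by_contra h
    have h1 := mem_zpowers_pow_of_not_dvd hp hG α h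
    rw [hs] at h1
    obtain ⟨i, hi⟩ := h1
    refine hx (hcent x ?_)
    simp only at hi
    rw [← hi]
    exact ((Commute.refl x).pow_right p).zpow_right i
  -- `x ^ p` commutes with `α`, so `k ^ p ≡ 1` modulo the order of `α`; reduce by Fermat.
  have hk1 : k ≡ 1 [MOD p] := by
    have h1 := conj_pow_eq_pow hk p 1
    have h2 : x ^ p * α = α * x ^ p := by
      rw [← hs]; exact (Commute.refl α).pow_left s
    rw [zpow_one, h2, one_mul, zpow_natCast] at h1
    have h3 := mul_right_cancel h1
    have h4 : k ^ p ≡ 1 [MOD orderOf α] := by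
      rw [← pow_eq_pow_iff_modEq, ← h3, pow_one]
    have h5 : k ^ p ≡ 1 [MOD p] := h4.of_dvd (hn ▸ dvd_pow_self p hn0)
    rw [← ZMod.natCast_eq_natCast_iff] at h5 ⊢
    rwa [Nat.cast_pow, ZMod.pow_card] at h5
  have hnot : ¬ (p = 2 → k ≡ 1 [MOD 4]) := by
    intro h4
    obtain ⟨u, hu, hup⟩ := exists_norm_eq_mul hp hk1 h4
    obtain ⟨s, rfl⟩ := hps
    exact hx (hU.mem_zpowers_of_norm hp hG hα hk hs.symm hu hup)
  push Not at hnot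
  obtain ⟨rfl, hk4⟩ := hnot
  obtain ⟨j, rfl⟩ : ∃ j, k = 4 * j + 3 :=
    ⟨k / 4, by unfold Nat.ModEq at hk1 hk4; omega⟩
  have hno (t : ℤ) : (α ^ t * x) ^ 2 ≠ 1 := fun h => hx <|
    (Subgroup.mul_mem_cancel_left _ (zpow_mem (Subgroup.mem_zpowers α) t)).1
      (hU.mem_zpowers_of_pow_eq_one hp hG hα h)
  have hx2 : x ^ 2 ≠ 1 := by simpa using hno 0
  -- `x` commutes with `x ^ 2 = α ^ s`, so `x ^ 2` is killed by `k - 1 = 2 * (2 * j + 1)`, whose odd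
  -- part is invertible in a 2-group.
  have hx4 : (x ^ 2) ^ 2 = 1 := by
    have h1 := conj_pow_eq_pow hk 1 s
    rw [pow_one, zpow_natCast, hs, ← pow_succ', pow_succ] at h1
    have h2 := mul_right_cancel h1
    have h3 : ((x ^ 2) ^ 2) ^ (2 * j + 1) = 1 := by
      rw [zpow_mul, zpow_natCast, zpow_natCast, hs, pow_one] at h2
      rw [← pow_mul]
      have h4 : (x ^ 2) ^ (2 * (2 * j + 1)) * x ^ 2 = x ^ 2 := by
        rw [← pow_succ]
        convert h2.symm using 2
        ring
      exact mul_eq_right.1 h4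
    obtain ⟨r, hr⟩ := hG.exists_orderOf_eq_pow ((x ^ 2) ^ 2)
    refine orderOf_eq_one_iff.1 (Nat.eq_one_of_dvd_coprimes ?_ hr.dvd
      (orderOf_dvd_of_pow_eq_one h3))
    exact (Nat.coprime_two_left.2 ⟨j, rfl⟩).pow_left r
  refine ⟨rfl, ?_, hx2, hx4⟩
  -- The exponent is `k + 1`. Otherwise some power `t` of `α ^ (k + 1)` is the involution `x ^ 2`,
  -- and then `(α ^ t * x) ^ 2 = x ^ 4 = 1`.
  have hinv : α ^ (4 * j + 4) = 1 := by
    by_contra hβ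
    obtain ⟨t, ht⟩ := hG.exists_orderOf_eq_prime hp hβ
    have h1 : (α ^ (4 * j + 4)) ^ t = x ^ 2 := hU.eq_of_involutions
      (orderOf_dvd_iff_pow_eq_one.1 ht.dvd) (fun h => by simp [h] at ht) hx4 hx2
    refine hno t ?_
    rw [mul_pow_eq_of_conj hk, ← hx4, sq (x ^ 2), mul_left_inj, ← h1, ← pow_mul, ← zpow_natCast]
    congr 1
    simp [Finset.sum_range_succ]
    ring
  have hinv' : α ^ (4 * j + 3) = α⁻¹ := by
    rw [eq_inv_iff_mul_eq_one, ← pow_succ, hinv]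
  rw [hinv'] at hk
  have h : SemiconjBy x α α⁻¹ := hk
  exact (inv_inv α ▸ h.inv_right).eq.symm

/-- A finite `p`-group with at most one subgroup of order `p` is cyclic or generalized
quaternion. -/
theorem HasUniquePrimeSubgroups.isCyclic_or_quaternion (hU : HasUniquePrimeSubgroups G)
    [Finite G] (hp : p.Prime) (hG : IsPGroup p G) :
    IsCyclic G ∨ p = 2 ∧ ∃ n, 3 ≤ n ∧ Nonempty (G ≃* GenQuaternion n) := by
  have := Fact.mk hp
  have := hG.isNilpotent
  obtain ⟨A, hnorm, hcomm, hself⟩ := Group.IsNilpotent.exists_selfCentralizing G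
  obtain ⟨α, rfl⟩ := hU.exists_eq_zpowers hp hG A hcomm
  have hcent : ∀ y, Commute y α → y ∈ Subgroup.zpowers α := by
    intro y hy
    refine hself (Subgroup.mem_centralizer_iff.2 ?_)
    rintro _ ⟨k, rfl⟩
    exact (hy.zpow_right k).symm
  by_cases hall : ∀ x, x ∈ Subgroup.zpowers α
  · exact Or.inl ⟨α, hall⟩
  right
  push Not at hall
  obtain ⟨x, hx⟩ := hall
  have hp2 : p = 2 := by
    obtain ⟨j, h1, h2⟩ := hG.exists_pow_notMem_pow_mem _ hx
    exact (hU.inverts_of_pow_mem hp hG hnorm hcent h1 (by rwa [← pow_mul, ← pow_succ])).1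
  subst hp2
  refine ⟨rfl, ?_⟩
  obtain ⟨n, hn⟩ := hG.exists_orderOf_eq_pow α
  have hsq1 : α ^ 2 ≠ 1 := by
    intro h
    obtain ⟨j, h1, h2⟩ := hG.exists_pow_notMem_pow_mem _ hx
    have h3 := (hU.inverts_of_pow_mem hp hG hnorm hcent h1 (by rwa [← pow_mul, ← pow_succ])).2.1
    rw [sq, mul_eq_one_iff_eq_inv] at h
    rw [← h] at h3
    exact h1 (hcent _ h3.symm)
  obtain ⟨m, rfl⟩ : ∃ m, n = m + 2 := by
    refine ⟨n - 2, ?_⟩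
    have : ¬ n ≤ 1 := fun h => hsq1 (orderOf_dvd_iff_pow_eq_one.1
      (hn ▸ (pow_dvd_pow 2 h).trans (by simp)))
    omega
  have key : ∀ y ∉ Subgroup.zpowers α, α * y = y * α⁻¹ ∧ y ^ 2 ≠ 1 ∧ (y ^ 2) ^ 2 = 1 := by
    intro y hy
    obtain ⟨j, h1, h2⟩ := hG.exists_pow_notMem_pow_mem _ hy
    have h3 := hU.inverts_of_pow_mem hp hG hnorm hcent h1 (by rwa [← pow_mul, ← pow_succ])
    obtain _ | j := j
    · simpa using h3.2
    -- Here `w ^ 2` inverts `α`, while `w` raises it to some power `k`; then `k ^ 2 ≡ -1` modulo 4,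
    -- which is impossible.
    exfalso
    set w := y ^ 2 ^ j with hw
    rw [pow_succ 2 j, pow_mul, ← hw] at h3
    obtain ⟨k, hk⟩ : ∃ k : ℕ, w * α = α ^ k * w := by
      obtain ⟨k, hk⟩ := mem_powers_iff_mem_zpowers.2
        (hnorm.conj_mem α (Subgroup.mem_zpowers α) w)
      exact ⟨k, by simp only at hk; rw [hk]; group⟩
    have h4 := conj_pow_eq_pow hk 2 1
    rw [zpow_one, one_mul, zpow_natCast] at h4
    have h5 : α * w ^ 2 * α = w ^ 2 := by rw [h3.2.1, inv_mul_cancel_right]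
    rw [mul_assoc, h4, ← mul_assoc, mul_eq_right, ← pow_succ', ← orderOf_dvd_iff_pow_eq_one,
      hn] at h5
    have h6 : 4 ∣ k ^ 2 + 1 := (dvd_mul_left 4 (2 ^ m)).trans (by simpa [pow_add] using h5)
    obtain ⟨l, rfl | rfl⟩ := Nat.even_or_odd' k
    · rw [mul_pow] at h6; omega
    · ring_nf at h6; omega
  obtain ⟨hx1, hx2, hx3⟩ := key x hx
  refine ⟨m + 3, by omega, ?_⟩
  refine (QuaternionGroup.nonempty_mulEquiv (m := 2 ^ (m + 1)) (α := α) (x := x)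
    (by rw [hn]; ring) hx hx1 (hU.eq_of_involutions hx3 hx2 ?_ ?_) fun g hg => hcent _ ?_).map
    MulEquiv.symm
  · rw [← pow_mul, ← pow_succ, ← hn, pow_orderOf_eq_one]
  · intro h
    have := orderOf_dvd_of_pow_eq_one h
    rw [hn, Nat.pow_dvd_pow_iff_le_right (by norm_num)] at this
    omega
  -- Both `x` and `g` invert `α`, so `x⁻¹ * g` centralizes it.
  · have h1 : SemiconjBy x α⁻¹ α := hx1.symm
    have h2 : SemiconjBy g α⁻¹ α := (key g hg).1.symm
    have h3 := (h1.inv_symm_left.mul_left h2).inv_right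
    rwa [inv_inv] at h3

end UniquePrimeSubgroup

/-! ### Assembling the Sylow factors -/

/-- Odd order excludes the quaternion case, so all Sylow subgroups are cyclic; a nilpotent group of
this kind is cyclic. -/
theorem HasUniquePrimeSubgroups.isCyclic_of_odd {G : Type*} [Group G] [Finite G]
    [Group.IsNilpotent G] (hU : HasUniquePrimeSubgroups G) (hodd : Odd (Nat.card G)) :
    IsCyclic G := by
  have : IsZGroup G := by
    refine ⟨fun p hp P => ?_⟩
    obtain h | ⟨rfl, -⟩ := (hU.of_injective _
      (P : Subgroup G).subtype_injective).isCyclic_or_quaternion hp P.isPGroup'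
    · exact h
    · have := Fact.mk hp
      obtain ⟨k, hk⟩ := IsPGroup.iff_card.1 P.isPGroup'
      have h1 : Nat.card P = 1 := Nat.eq_one_of_dvd_coprimes
        ((Nat.coprime_two_left.2 hodd).pow_left k) hk.dvd (Subgroup.card_subgroup_dvd_card _)
      have := (Nat.card_eq_one_iff_unique.1 h1).1
      exact isCyclic_of_subsingleton
  infer_instance

/-- Splitting off one factor of a product of groups. -/
def MulEquiv.piSplitAt {ι : Type*} [DecidableEq ι] (i : ι) (P : ι → Type*) [∀ i, Group (P i)] :
    (∀ j, P j) ≃* P i × ∀ j : { j // j ≠ i }, P j :=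
  { Equiv.piSplitAt i P with map_mul' := fun _ _ => rfl }

theorem HasUniquePrimeSubgroups.isCyclic_or_quaternion_prod {G : Type*} [Group G] [Finite G]
    [Group.IsNilpotent G] (hU : HasUniquePrimeSubgroups G) :
    IsCyclic G ∨ ∃ n m : ℕ, 3 ≤ n ∧ Odd m ∧
      Nonempty (G ≃* GenQuaternion n × Multiplicative (ZMod m)) := by
  classical
  obtain ⟨P, hP, hnt, ⟨f⟩⟩ := Group.IsNilpotent.exists_mulEquiv_pi G
  have hprime (p : (Nat.card G).primeFactors) : p.1.Prime := Nat.prime_of_mem_primeFactors p.2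
  by_cases h2 : 2 ∈ (Nat.card G).primeFactors
  · let i : (Nat.card G).primeFactors := ⟨2, h2⟩
    have hco := IsPGroup.pairwise_coprime_card (P := fun p => P p)
      (fun p hp => Nat.prime_of_mem_primeFactors hp) hP
    let K := ∀ j : { j // j ≠ i }, P j
    let e : G ≃* P i × K := f.symm.trans (MulEquiv.piSplitAt i fun p => P p)
    have hcoK : (Nat.card (P i)).Coprime (Nat.card K) := by
      rw [Nat.card_pi]
      exact Nat.Coprime.prod_right fun j _ => hco j.2.symm
    have hKodd : Odd (Nat.card K) := by
      rw [← Nat.coprime_two_left]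
      refine hcoK.coprime_dvd_left ?_
      have := Fact.mk Nat.prime_two
      obtain ⟨n, hn, hc⟩ := (hP i).nontrivial_iff_card.1 (hnt i)
      exact hc ▸ dvd_pow_self 2 hn.ne'
    have hKnil : Group.IsNilpotent K :=
      Group.nilpotent_of_surjective ((MonoidHom.snd (P i) K).comp e.toMonoidHom)
        (Prod.snd_surjective.comp e.surjective)
    have hK : IsCyclic K := (hU.of_injective (e.symm.toMonoidHom.comp (MonoidHom.inr (P i) K))
      (e.symm.injective.comp (Prod.mk_right_injective 1))).isCyclic_of_odd hKodd
    obtain hc | ⟨-, n, hn, ⟨q⟩⟩ := (hU.of_injective _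
      (P i).subtype_injective).isCyclic_or_quaternion Nat.prime_two (hP i)
    · left
      have : IsCyclic (P i × K) := Group.isCyclic_prod_iff.2 ⟨hc, hK, hcoK⟩
      exact isCyclic_of_surjective e.symm e.symm.surjective
    · exact Or.inr ⟨n, Nat.card K, hn, hKodd,
        ⟨e.trans (q.prodCongr (zmodCyclicMulEquiv hK).symm)⟩⟩
  · left
    refine hU.isCyclic_of_odd (Nat.not_even_iff_odd.1 fun h => h2 ?_)
    exact Nat.mem_primeFactors.2 ⟨Nat.prime_two, h.two_dvd, Nat.card_pos.ne'⟩

theorem theorem2 (G : Type u) [Group G] [Finite G] [Group.IsNilpotent G] :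
    IsTwoClosedGroup.{u, v} G ↔
      IsCyclic G ∨
        ∃ n m : ℕ, 3 ≤ n ∧ Odd m ∧
          Nonempty (G ≃* GenQuaternion n × Multiplicative (ZMod m)) := by
  refine ⟨fun h => h.hasUniquePrimeSubgroups.isCyclic_or_quaternion_prod, ?_⟩
  rintro (h | ⟨n, m, -, hm, ⟨e⟩⟩)
  · exact (HasUniquePrimeSubgroups.of_isCyclic G).isTwoClosedGroup
  · exact ((HasUniquePrimeSubgroups.of_quaternion_prod n m hm).of_injective e.toMonoidHom
      e.injective).isTwoClosedGroup
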